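/- Let $G$ be a Hausdorff, locally compact, second countable, unimodular topological group with centre $Z$, Haar measure $\mu$ and quotient group $X=G/Z$; let $p:G\to X$ be the projection, $s:X\to G$ a Borel section of $p$, and $\alpha$ a Haar measure on $X$. Scalar products are linear in the second argument. Let $(\pi,\mathcal H)$ be a (strongly) continuous irreducible unitary representation of $G$ on a complex separable Hilbert space. For $u,v\in\mathcal H$ put $c_{u,v}(g)=\langle \pi(g)u,v\rangle$, and assume that $\pi$ is square integrable modulo the centre, i.e. $c_{u,v}\circ s\in L^2(X,\alpha)$ for all $u,v\in\mathcal H$. Assume that $\alpha$ is normalised so that the formal degree of $\pi$ is $1$, i.e. $\int_X|c_{u_0,v_0}(s(x))|^2\,d\alpha(x)=1$ for some pair (equivalently, for every pair) of unit vectors $u_0,v_0\in\mathcal H$. Then $\pi$ has a central character: there is a continuous character $\chi:Z\to\mathbb T$ with $\pi(h)=\chi(h)I$ for all $h\in Z$. Let $\mathcal H^\chi$ be the Hilbert space of $\mu$-equivalence classes of measurable functions $f:G\to\mathbb C$ such that $f(gh)=\chi(h^{-1})f(g)$ for all $g\in G$, $h\in Z$, and $f\circ s\in L^2(X,\alpha)$,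 with scalar product $\langle f_1,f_2\rangle=\int_X\overline{f_1(s(x))}f_2(s(x))\,d\alpha(x)$. For Borel $E\subseteq X$ let $P(E)$ be the operator $(P(E)f)(g)=1_E(p(g))f(g)$ on $\mathcal H^\chi$. For every unit vector $u\in\mathcal H$ let $W_u:\mathcal H\to\mathcal H^\chi$, $W_uv=c_{u,v}$. Then: 1. For every Borel set $E\subseteq X$ the weak integral $Q_u(E)=\int_E\pi(s(x))\,|u\rangle\langle u|\,\pi(s(x))^{-1}\,d\alpha(x)$ exists as a bounded operator on $\mathcal H$. 2. $(\mathcal H^\chi,P,W_u)$ is a Neumark dilation of $Q_u$: $Q_u$ is a positive operator measure on $X$ with $Q_u(X)=I$, $P$ is a projection measure, $W_u$ is a linear isometry, and $\langle W_uv,P(E)W_uw\rangle=\langle v,Q_u(E)w\rangle$ for all Borel $E\subseteq X$ and all $v,w\in\mathcal H$. 3. This dilation is minimal: $$\mathcal H^\chi=\overline{\operatorname{span}}\,\{P(E)f \mid E\subseteq X\text{ Borel},\ f\in\operatorname{ran}W_u\}.$$ -/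

import Mathlib

open MeasureTheory Filter Topology
open scoped InnerProductSpace ENNReal

noncomputable section

namespace PhaseSpace

section Group

variable (G : Type*) [Group G] [TopologicalSpace G] [IsTopologicalGroup G]

/-- The phase space `X = G / Z`, the quotient of `G` by its centre. -/
abbrev X : Type _ := G ⧸ Subgroup.center G

instance instIsClosedCenter [T2Space G] : IsClosed ((Subgroup.center G : Subgroup G) : Set G) := by
  have h : ((Subgroup.center G : Subgroup G) : Set G) = ⋂ g : G, {z | g * z = z * g} := by
    ext z
    simp [Subgroup.mem_center_iff]
  rw [h]
  exact isClosed_iInter fun g => isClosed_eq (by fun_prop) (by fun_prop)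

instance instBorelSpaceX [T2Space G] [LocallyCompactSpace G] [SecondCountableTopology G]
    [MeasurableSpace G] [BorelSpace G] : BorelSpace (X G) := by
  let : UniformSpace G := IsTopologicalGroup.rightUniformSpace G
  have : IsRightUniformGroup G := { uniformity_eq := rfl }
  have : CompleteSpace G := IsRightUniformGroup.completeSpace_of_weaklyLocallyCompactSpace
  have : (uniformity G).IsCountablyGenerated := by
    rw [uniformity_eq_comap_nhds_one]
    infer_instance
  have : PolishSpace G := inferInstance
  infer_instance

/-- A Borel section of the canonical projection `G → G / Z`. -/
structure BorelSection [MeasurableSpace G] where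
  /-- the underlying map -/
  toFun : X G → G
  measurable' : Measurable toFun
  mk_toFun' : ∀ x, (QuotientGroup.mk (toFun x) : X G) = x

instance [MeasurableSpace G] : CoeFun (BorelSection G) (fun _ => X G → G) := ⟨BorelSection.toFun⟩

end Group

section InducedSpace

set_option linter.unusedSectionVars false

variable {G : Type*} [Group G] [TopologicalSpace G] [IsTopologicalGroup G]
  [T2Space G] [LocallyCompactSpace G] [SecondCountableTopology G]
  [MeasurableSpace G] [BorelSpace G]
  (χ : Subgroup.center G →ₜ* Circle) (s : BorelSection G)
  (μ : Measure G) (α : Measure (X G))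

/-- The measurable functions `f : G → ℂ` with `f (g h) = χ(h⁻¹) f g` for `h` in the centre and
`f ∘ s ∈ L²(X, α)`. -/
def covFun : Submodule ℂ (G → ℂ) where
  carrier := {f | Measurable f ∧
    (∀ (g : G) (h : Subgroup.center G), f (g * h) = (χ h⁻¹ : ℂ) * f g) ∧
    MemLp (fun x => f (s x)) 2 α}
  add_mem' := by
    rintro f f' ⟨h1, h2, h3⟩ ⟨k1, k2, k3⟩
    refine ⟨h1.add k1, fun g h => ?_, h3.add k3⟩
    simp only [Pi.add_apply, h2, k2, mul_add]
  zero_mem' := ⟨measurable_zero, by simp, by simp⟩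
  smul_mem' := by
    rintro c f ⟨h1, h2, h3⟩
    refine ⟨h1.const_smul c, fun g h => ?_, h3.const_smul c⟩
    simp only [Pi.smul_apply, h2, smul_eq_mul]
    ring

/-- The functions that vanish `μ`-almost everywhere on `G`. -/
def nullFun : Submodule ℂ (covFun χ s α) where
  carrier := {f | f.1 =ᵐ[μ] 0}
  add_mem' := by
    intro f f' h k
    change f.1 + f'.1 =ᵐ[μ] 0
    have h' : f.1 =ᵐ[μ] 0 := h
    have k' : f'.1 =ᵐ[μ] 0 := k
    simpa using h'.add k'
  zero_mem' := by
    change (0 : G → ℂ) =ᵐ[μ] 0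
    rfl
  smul_mem' := by
    intro c f h
    change c • f.1 =ᵐ[μ] 0
    have h' : f.1 =ᵐ[μ] 0 := h
    simpa using h'.const_smul c

/-- The space `H^χ` of `μ`-equivalence classes of functions in `covFun`. -/
def HChi : Type _ := covFun χ s α ⧸ nullFun χ s μ α

instance : AddCommGroup (HChi χ s μ α) :=
  inferInstanceAs (AddCommGroup (covFun χ s α ⧸ nullFun χ s μ α))

instance : Module ℂ (HChi χ s μ α) :=
  inferInstanceAs (Module ℂ (covFun χ s α ⧸ nullFun χ s μ α))

/-- The class in `H^χ` of a function. -/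
def HChi.mk : covFun χ s α →ₗ[ℂ] HChi χ s μ α := (nullFun χ s μ α).mkQ

variable {χ s μ α}

theorem HChi.mk_surjective : Function.Surjective (HChi.mk χ s μ α) :=
  Submodule.mkQ_surjective _

/-- For a Borel set `B` of `X`: `p⁻¹(B)` is `μ`-null iff `B` is `α`-null. -/
theorem measure_preimage_eq_zero_iff [μ.IsHaarMeasure] [μ.IsMulRightInvariant] [α.IsHaarMeasure]
    {B : Set (X G)} (hB : MeasurableSet B) :
    μ ((QuotientGroup.mk : G → X G) ⁻¹' B) = 0 ↔ α B = 0 := by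
  have hp : Measurable (QuotientGroup.mk : G → X G) := QuotientGroup.continuous_mk.measurable
  have hS : MeasurableSet {z : G × X G | (QuotientGroup.mk z.1 : X G) * z.2 ∈ B} :=
    ((hp.comp measurable_fst).mul measurable_snd) hB
  have h1 : (μ.prod α) {z : G × X G | (QuotientGroup.mk z.1 : X G) * z.2 ∈ B} = 0 ↔
      α B = 0 := by
    rw [Measure.measure_prod_null hS]
    have : ∀ g : G, α (Prod.mk g ⁻¹' {z : G × X G | (QuotientGroup.mk z.1 : X G) * z.2 ∈ B})
        = α B := fun g => measure_preimage_mul α (QuotientGroup.mk g : X G) B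
    simp only [this]
    constructor
    · intro h
      obtain ⟨g, hg⟩ := h.exists
      exact hg
    · intro h
      exact Eventually.of_forall fun _ => h
  have h2 : (μ.prod α) {z : G × X G | (QuotientGroup.mk z.1 : X G) * z.2 ∈ B} = 0 ↔
      μ ((QuotientGroup.mk : G → X G) ⁻¹' B) = 0 := by
    rw [Measure.prod_apply_symm hS, lintegral_eq_zero_iff (measurable_measure_prodMk_right hS)]
    have : ∀ x : X G,
        μ ((fun g => (g, x)) ⁻¹' {z : G × X G | (QuotientGroup.mk z.1 : X G) * z.2 ∈ B})
          = μ ((QuotientGroup.mk : G → X G) ⁻¹' B) := by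
      intro x
      obtain ⟨y, rfl⟩ := QuotientGroup.mk_surjective x
      exact measure_preimage_mul_right μ y ((QuotientGroup.mk : G → X G) ⁻¹' B)
    simp only [this]
    constructor
    · intro h
      obtain ⟨g, hg⟩ := h.exists
      exact hg
    · intro h
      exact Eventually.of_forall fun _ => h
  exact h2.symm.trans h1

theorem covFun_norm_mk_section {f : G → ℂ} (hf : f ∈ covFun χ s α) (g : G) :
    ‖f (s (QuotientGroup.mk g : X G))‖ = ‖f g‖ := by
  have hz : g⁻¹ * s (QuotientGroup.mk g : X G) ∈ Subgroup.center G :=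
    QuotientGroup.eq.1 (s.mk_toFun' (QuotientGroup.mk g : X G)).symm
  have h := hf.2.1 g ⟨_, hz⟩
  simp only [mul_inv_cancel_left] at h
  rw [h, norm_mul, Circle.norm_coe, one_mul]

/-- An element of `covFun` vanishes `μ`-a.e. iff its restriction to the section vanishes
`α`-a.e. -/
theorem covFun_ae_zero_iff [μ.IsHaarMeasure] [μ.IsMulRightInvariant] [α.IsHaarMeasure]
    {f : G → ℂ} (hf : f ∈ covFun χ s α) :
    f =ᵐ[μ] 0 ↔ (fun x => f (s x)) =ᵐ[α] 0 := by
  have hB : MeasurableSet {x : X G | f (s x) ≠ 0} :=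
    (hf.1.comp s.measurable') (MeasurableSet.singleton (0 : ℂ)).compl
  have h := measure_preimage_eq_zero_iff (μ := μ) (α := α) hB
  have hpre : (QuotientGroup.mk : G → X G) ⁻¹' {x : X G | f (s x) ≠ 0} = {g | f g ≠ 0} := by
    ext g
    change f (s (QuotientGroup.mk g : X G)) ≠ 0 ↔ f g ≠ 0
    rw [← norm_ne_zero_iff, covFun_norm_mk_section hf g, norm_ne_zero_iff]
  rw [hpre] at h
  exact h

variable (χ s μ α)

/-- Restriction to the section, `f ↦ f ∘ s`, from `covFun` to `L²(X, α)`. -/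
def covFunToLp : covFun χ s α →ₗ[ℂ] Lp ℂ 2 α where
  toFun f := MemLp.toLp (fun x => f.1 (s x)) f.2.2.2
  map_add' _ _ := rfl
  map_smul' _ _ := rfl

variable [μ.IsHaarMeasure] [μ.IsMulRightInvariant] [α.IsHaarMeasure]

theorem ker_covFunToLp : LinearMap.ker (covFunToLp χ s α) = nullFun χ s μ α := by
  ext f
  rw [LinearMap.mem_ker]
  have h1 : covFunToLp χ s α f = 0 ↔ (fun x => f.1 (s x)) =ᵐ[α] 0 :=
    MemLp.toLp_eq_toLp_iff f.2.2.2 MemLp.zero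
  rw [h1, ← covFun_ae_zero_iff (μ := μ) f.2]
  rfl

/-- Restriction to the section on `H^χ`. -/
def HChi.toLp : HChi χ s μ α →ₗ[ℂ] Lp ℂ 2 α :=
  (nullFun χ s μ α).liftQ (covFunToLp χ s α) (ker_covFunToLp χ s μ α).ge

theorem HChi.toLp_mk (f : covFun χ s α) :
    HChi.toLp χ s μ α (HChi.mk χ s μ α f) = MemLp.toLp (fun x => f.1 (s x)) f.2.2.2 := rfl

theorem HChi.toLp_injective : Function.Injective (HChi.toLp χ s μ α) := by
  rw [← LinearMap.ker_eq_bot]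
  exact Submodule.ker_liftQ_eq_bot _ _ _ (ker_covFunToLp χ s μ α).le

theorem HChi.toLp_surjective : Function.Surjective (HChi.toLp χ s μ α) := by
  intro φ
  have hp : Measurable (QuotientGroup.mk : G → X G) := QuotientGroup.continuous_mk.measurable
  have hz : ∀ g : G, (s (QuotientGroup.mk g : X G))⁻¹ * g ∈ Subgroup.center G := fun g =>
    QuotientGroup.eq.1 (s.mk_toFun' (QuotientGroup.mk g : X G))
  let z : G → Subgroup.center G := fun g => ⟨_, hz g⟩
  have hzm : Measurable z :=
    (((s.measurable'.comp hp).inv).mul measurable_id).subtype_mk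
  let f : G → ℂ := fun g => ((χ (z g)⁻¹ : Circle) : ℂ) * φ (QuotientGroup.mk g : X G)
  have hfs : (fun x => f (s x)) = φ := by
    funext x
    have h1 : z (s x) = 1 := by
      apply Subtype.ext
      simp [z, s.mk_toFun' x]
    simp [f, h1, s.mk_toFun' x]
  have hf : f ∈ covFun χ s α := by
    refine ⟨?_, ?_, ?_⟩
    · refine Measurable.mul ?_ ((Lp.stronglyMeasurable φ).measurable.comp hp)
      exact (continuous_subtype_val.comp χ.continuous_toFun).measurable.comp hzm.inv
    · intro g h
      have hmk : (QuotientGroup.mk (g * (h : G)) : X G) = QuotientGroup.mk g :=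
        QuotientGroup.mk_mul_of_mem g h.2
      have h2 : z (g * h) = z g * h := by
        apply Subtype.ext
        simp [z, hmk, mul_assoc]
      have h3 : ((χ (z g * h)⁻¹ : Circle) : ℂ) = (χ h⁻¹ : ℂ) * (χ (z g)⁻¹ : ℂ) := by
        rw [mul_inv_rev, map_mul, Circle.coe_mul]
      simp only [f, h2, hmk, h3, mul_assoc]
    · rw [hfs]
      exact Lp.memLp φ
  refine ⟨HChi.mk χ s μ α ⟨f, hf⟩, ?_⟩
  rw [HChi.toLp_mk]
  simp only [hfs, Lp.toLp_coeFn]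

/-- The scalar product of `H^χ`, see `HChi.inner_mk_mk`. -/
instance HChi.instCore : InnerProductSpace.Core ℂ (HChi χ s μ α) where
  inner a b := ⟪HChi.toLp χ s μ α a, HChi.toLp χ s μ α b⟫_ℂ
  conj_inner_symm a b := inner_conj_symm _ _
  re_inner_nonneg a := inner_self_nonneg
  add_left a b c := by rw [map_add, inner_add_left]
  smul_left a b r := by rw [map_smul, inner_smul_left]
  definite a h := HChi.toLp_injective χ s μ α (by rw [map_zero, inner_self_eq_zero.1 h])

instance HChi.instNormedAddCommGroup : NormedAddCommGroup (HChi χ s μ α) :=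
  (HChi.instCore χ s μ α).toNormedAddCommGroup

instance HChi.instInnerProductSpace : InnerProductSpace ℂ (HChi χ s μ α) :=
  InnerProductSpace.ofCore (HChi.instCore χ s μ α).toCore

/-- The scalar product of `H^χ` is `∫_X conj (f₁(s(x))) f₂(s(x)) dα(x)`. -/
theorem HChi.inner_mk_mk (f₁ f₂ : covFun χ s α) :
    ⟪HChi.mk χ s μ α f₁, HChi.mk χ s μ α f₂⟫_ℂ =
      ∫ x, (starRingEnd ℂ) (f₁.1 (s x)) * f₂.1 (s x) ∂α := by
  change ⟪HChi.toLp χ s μ α (HChi.mk χ s μ α f₁), HChi.toLp χ s μ α (HChi.mk χ s μ α f₂)⟫_ℂ = _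
  rw [HChi.toLp_mk, HChi.toLp_mk, L2.inner_def]
  refine integral_congr_ae ?_
  filter_upwards [f₁.2.2.2.coeFn_toLp, f₂.2.2.2.coeFn_toLp] with x h1 h2
  rw [h1, h2, RCLike.inner_apply, mul_comm]

theorem HChi.norm_toLp (a : HChi χ s μ α) : ‖HChi.toLp χ s μ α a‖ = ‖a‖ := by
  rw [@norm_eq_sqrt_re_inner ℂ, @norm_eq_sqrt_re_inner ℂ _ _ _ _ a]
  rfl

/-- `H^χ` is a Hilbert space. -/
instance HChi.instCompleteSpace : CompleteSpace (HChi χ s μ α) :=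
  (LinearIsometryEquiv.ofSurjective
    (⟨HChi.toLp χ s μ α, HChi.norm_toLp χ s μ α⟩ : HChi χ s μ α →ₗᵢ[ℂ] Lp ℂ 2 α)
    (HChi.toLp_surjective χ s μ α)).toIsometryEquiv.completeSpace

/-- Multiplication of functions on `G` by the indicator function of `p⁻¹(E)`. -/
def covFunIndicator (E : Set (X G)) (hE : MeasurableSet E) :
    covFun χ s α →ₗ[ℂ] covFun χ s α where
  toFun f := ⟨((QuotientGroup.mk : G → X G) ⁻¹' E).indicator f.1, by
    obtain ⟨f, h1, h2, h3⟩ := f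
    refine ⟨h1.indicator (QuotientGroup.continuous_mk.measurable hE), fun g h => ?_, ?_⟩
    · have hmk : (QuotientGroup.mk (g * (h : G)) : X G) = QuotientGroup.mk g :=
        QuotientGroup.mk_mul_of_mem g h.2
      by_cases hg : (QuotientGroup.mk g : X G) ∈ E
      · simp [Set.indicator, hmk, hg, h2]
      · simp [Set.indicator, hmk, hg]
    · have : (fun x => ((QuotientGroup.mk : G → X G) ⁻¹' E).indicator f (s x)) =
          E.indicator fun x => f (s x) := by
        funext x
        have hx : s x ∈ (QuotientGroup.mk : G → X G) ⁻¹' E ↔ x ∈ E := by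
          change (QuotientGroup.mk (s x) : X G) ∈ E ↔ x ∈ E
          rw [s.mk_toFun' x]
        by_cases h : x ∈ E
        · rw [Set.indicator_of_mem h, Set.indicator_of_mem (hx.2 h)]
        · rw [Set.indicator_of_notMem h, Set.indicator_of_notMem (mt hx.1 h)]
      rw [this]
      exact h3.indicator hE⟩
  map_add' f f' := Subtype.ext (Set.indicator_add _ _ _)
  map_smul' c f := by
    apply Subtype.ext
    funext g
    exact congrFun (Set.indicator_const_smul ((QuotientGroup.mk : G → X G) ⁻¹' E) c f.1) g

open Classical in
/-- The canonical projection measure on `H^χ`: for a Borel set `E`, `P(E)` is induced by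
multiplication by the indicator function of `p⁻¹(E)`, see `canonicalPM_mk`
(conventionally `0` for a non-Borel `E`). -/
def canonicalPM (E : Set (X G)) : HChi χ s μ α →L[ℂ] HChi χ s μ α :=
  if hE : MeasurableSet E then
    LinearMap.mkContinuous
      ((nullFun χ s μ α).mapQ (nullFun χ s μ α) (covFunIndicator χ s α E hE) (by
        intro f hf
        have hf' : f.1 =ᵐ[μ] 0 := hf
        rw [Submodule.mem_comap]
        change ((QuotientGroup.mk : G → X G) ⁻¹' E).indicator f.1 =ᵐ[μ] 0
        filter_upwards [hf'] with g hg
        simp only [Set.indicator_apply, hg]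
        simp)) 1 (by
        intro a
        obtain ⟨f, rfl⟩ := HChi.mk_surjective a
        rw [one_mul, ← HChi.norm_toLp, ← HChi.norm_toLp]
        change ‖HChi.toLp χ s μ α (HChi.mk χ s μ α (covFunIndicator χ s α E hE f))‖ ≤ _
        rw [HChi.toLp_mk, HChi.toLp_mk]
        refine Lp.norm_le_norm_of_ae_le ?_
        filter_upwards [f.2.2.2.coeFn_toLp,
          (covFunIndicator χ s α E hE f).2.2.2.coeFn_toLp] with x h1 h2
        rw [h1, h2]
        exact norm_indicator_le_norm_self f.1 (s x))
  else 0

theorem canonicalPM_mk (E : Set (X G)) (hE : MeasurableSet E) (f : covFun χ s α) :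
    canonicalPM χ s μ α E (HChi.mk χ s μ α f) =
      HChi.mk χ s μ α (covFunIndicator χ s α E hE f) := by
  rw [canonicalPM, dif_pos hE]
  rfl

end InducedSpace

section Representation

variable (G : Type*) [Group G] [TopologicalSpace G]
  (H : Type*) [NormedAddCommGroup H] [InnerProductSpace ℂ H] [CompleteSpace H]

/-- A (strongly) continuous unitary representation of `G` on the Hilbert space `H`. -/
structure UnitaryRep where
  /-- the underlying homomorphism into the unitary group -/
  toHom : G →* unitary (H →L[ℂ] H)
  continuous' : ∀ v : H, Continuous fun g => (toHom g : H →L[ℂ] H) v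

end Representation

section Observable

variable {G : Type*} [Group G] [TopologicalSpace G] 
  {H : Type*} [NormedAddCommGroup H] [InnerProductSpace ℂ H] [CompleteSpace H]

/-- The operator `π(g)`. -/
def UnitaryRep.op (π : UnitaryRep G H) (g : G) : H →L[ℂ] H := (π.toHom g : H →L[ℂ] H)

/-- Irreducibility: `H ≠ 0` and the only closed invariant subspaces are `0` and `H`. -/
def UnitaryRep.IsIrreducible (π : UnitaryRep G H) : Prop :=
  Nontrivial H ∧ ∀ V : Submodule ℂ H, IsClosed (V : Set H) →
    (∀ g : G, ∀ v ∈ V, π.op g v ∈ V) → V = ⊥ ∨ V = ⊤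

/-- `χ` is the central character of `π`: `π(h) = χ(h) I` for all `h` in the centre. -/
def UnitaryRep.IsCentralCharacter (π : UnitaryRep G H) (χ : Subgroup.center G →ₜ* Circle) : Prop :=
  ∀ h : Subgroup.center G, π.op (h : G) = (χ h : ℂ) • (1 : H →L[ℂ] H)

/-- The coefficient `c_{u,v}(g) = ⟨π(g) u, v⟩`; the scalar product is linear in the second
argument. -/
def UnitaryRep.coeff (π : UnitaryRep G H) (u v : H) (g : G) : ℂ := ⟪π.op g u, v⟫_ℂ

variable [IsTopologicalGroup G] [MeasurableSpace G]

/-- `π` is square integrable modulo the centre. -/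
def UnitaryRep.IsSquareIntegrableModCenter (π : UnitaryRep G H) (s : BorelSection G)
    (α : Measure (X G)) : Prop :=
  ∀ u v : H, MemLp (fun x => π.coeff u v (s x)) 2 α

/-- The measure `α` is normalised so that the formal degree of `π` is one: since
`‖c_{u,v}‖² = ‖u‖² ‖v‖² / d_π` for all `u` and `v`, it is enough to ask this
of one pair of unit vectors. -/
def UnitaryRep.HasUnitFormalDegree (π : UnitaryRep G H) (s : BorelSection G)
    (α : Measure (X G)) : Prop :=
  ∃ u v : H, ‖u‖ = 1 ∧ ‖v‖ = 1 ∧ ∫ x, ‖π.coeff u v (s x)‖ ^ 2 ∂α = 1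

/-- `A` is the weak integral of the operator valued function `F`. -/
def IsWeakIntegral {Y : Type*} [MeasurableSpace Y] (F : Y → H →L[ℂ] H) (ν : Measure Y)
    (A : H →L[ℂ] H) : Prop :=
  ∀ v w : H, Integrable (fun y => ⟪v, F y w⟫_ℂ) ν ∧ ⟪v, A w⟫_ℂ = ∫ y, ⟪v, F y w⟫_ℂ ∂ν

open Classical in
/-- The weak integral `∫ F dν` as a bounded operator (conventionally `0` if it does not exist). -/
def weakIntegral {Y : Type*} [MeasurableSpace Y] (F : Y → H →L[ℂ] H) (ν : Measure Y) :
    H →L[ℂ] H :=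
  if h : ∃ A, IsWeakIntegral F ν A then h.choose else 0

/-- The integrand `x ↦ π(s(x)) T π(s(x))⁻¹`. -/
def UnitaryRep.orbit (π : UnitaryRep G H) (s : BorelSection G) (T : H →L[ℂ] H) (x : X G) :
    H →L[ℂ] H :=
  π.op (s x) ∘L T ∘L π.op (s x)⁻¹

/-- The phase space observable `Q_T(E) = ∫_E π(s(x)) T π(s(x))⁻¹ dα(x)`, a weak integral. -/
def UnitaryRep.phaseSpaceObs (π : UnitaryRep G H) (s : BorelSection G) (α : Measure (X G))
    (T : H →L[ℂ] H) (E : Set (X G)) : H →L[ℂ] H :=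
  weakIntegral (π.orbit s T) (α.restrict E)

/-- The phase space observable `Q_u` of the pure state `|u⟩⟨u|`. -/
def UnitaryRep.pureObs (π : UnitaryRep G H) (s : BorelSection G) (α : Measure (X G))
    (u : H) (E : Set (X G)) : H →L[ℂ] H :=
  π.phaseSpaceObs s α (InnerProductSpace.rankOne ℂ u u) E

variable [T2Space G] [LocallyCompactSpace G] [SecondCountableTopology G] [BorelSpace G]

/-- The linear map `W_u : H → H^χ`, `W_u v = c_{u,v}`. -/
def UnitaryRep.W (π : UnitaryRep G H) (χ : Subgroup.center G →ₜ* Circle) (s : BorelSection G)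
    (μ : Measure G) (α : Measure (X G)) (hχ : π.IsCentralCharacter χ)
    (hπ : π.IsSquareIntegrableModCenter s α) (u : H) : H →ₗ[ℂ] HChi χ s μ α :=
  HChi.mk χ s μ α ∘ₗ
    { toFun := fun v => ⟨π.coeff u v, by
        refine ⟨?_, fun g h => ?_, hπ u v⟩
        · have : Continuous fun g => π.coeff u v g := (π.continuous' u).inner continuous_const
          exact this.measurable
        · have h1 : π.op (g * h) u = (χ h : ℂ) • π.op g u := by
            have h2 : (g : G) * h = h * g := Subgroup.mem_center_iff.1 h.2 g
            have h3 : π.op (h * g) = π.op h * π.op g := by simp [UnitaryRep.op]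
            rw [h2, h3, hχ h]
            simp
          rw [UnitaryRep.coeff, h1, inner_smul_left, map_inv, Circle.coe_inv_eq_conj]
          rfl⟩
      map_add' := fun v w => Subtype.ext (funext fun g => inner_add_right _ _ _)
      map_smul' := fun c v => Subtype.ext (funext fun g => inner_smul_right _ _ _) }

end Observable

section Dilation

variable {Y : Type*} [MeasurableSpace Y]
  {H : Type*} [NormedAddCommGroup H] [InnerProductSpace ℂ H]
  {K : Type*} [NormedAddCommGroup K] [InnerProductSpace ℂ K]

/-- A normalised positive operator measure (POM) on `Y`. -/
structure IsPOM (Q : Set Y → H →L[ℂ] H) : Prop where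
  isPositive : ∀ E, MeasurableSet E → (Q E).IsPositive
  univ : Q Set.univ = 1
  hasSum : ∀ E : ℕ → Set Y, (∀ n, MeasurableSet (E n)) → Pairwise (Function.onFun Disjoint E) →
    ∀ v w : H, HasSum (fun n => ⟪v, Q (E n) w⟫_ℂ) ⟪v, Q (⋃ n, E n) w⟫_ℂ

/-- A projection measure: a POM whose values are orthogonal projections. -/
structure IsProjectionMeasure [CompleteSpace H] (P : Set Y → H →L[ℂ] H) : Prop
    extends IsPOM P where
  isStarProjection : ∀ E, MeasurableSet E → IsStarProjection (P E)

/-- `(K, P, W)` is a Neumark dilation of the POM `Q`: `P` is a projection measure on the Hilbert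
space `K`, `W : H → K` is an isometry and `Q(E) = W* P(E) W` for all measurable `E`. -/
structure IsNeumarkDilation [CompleteSpace K] (Q : Set Y → H →L[ℂ] H) (P : Set Y → K →L[ℂ] K)
    (W : H →ₗ[ℂ] K) : Prop where
  isPOM : IsPOM Q
  isProjectionMeasure : IsProjectionMeasure P
  isometry : ∀ v, ‖W v‖ = ‖v‖
  inner_eq : ∀ E, MeasurableSet E → ∀ v w, ⟪W v, P E (W w)⟫_ℂ = ⟪v, Q E w⟫_ℂ

/-- Minimality: the closed linear span of the vectors `P(E) f`, with `E` measurable and `f` in the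
range of `W`, is `K`. -/
def IsMinimalDilation (P : Set Y → K →L[ℂ] K) (W : H →ₗ[ℂ] K) : Prop :=
  (Submodule.span ℂ {k : K | ∃ E, MeasurableSet E ∧ ∃ f ∈ LinearMap.range W,
    k = P E f}).topologicalClosure = ⊤

end Dilation

end PhaseSpace

end

/-! Restriction to the section, `f ↦ f ∘ s`, turns `H^χ` into `L²(X, α)` and `P(E)` into
multiplication by `1_E`. The matrix element of the integrand of `Q_u` at `v, w` is `conj c_{u,v} *
c_{u,w}`, so `Q_u(E) = W_u* P(E) W_u`. Positivity and additivity pass from `P` to `Q_u`, and `Q_u(X)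
= I` says that `W_u` is an isometry.

The isometry is Schur orthogonality. `W_u` is bounded by the closed graph theorem, and left
invariance of `α` makes `W_u* W_u` commute with `π`; hence `⟪W_u v, W_u w⟫ = c_u ⟪v, w⟫`. The
constants for different unit vectors are compared through `c_{u,v}(g⁻¹) = conj c_{v,u}(g)`, which
gives `‖W_u v‖ = ‖W_v u‖` once `α` is invariant under inversion. This needs `X` to be unimodular,
which is derived from the unimodularity of `G` by disintegrating `μ` over the centre. The
normalisation then makes every constant 1.

For minimality, a class `f` orthogonal to all `P(E) W_u v` satisfies `conj f * c_{u,v} = 0` almost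
everywhere for every `v`. Separability provides one null set for a dense sequence of `v`; off it,
`f(s x) ≠ 0` would force `π(s x) u = 0`. -/

namespace PhaseSpace

/-! ### Unimodularity of `G / Z`, and invariance of its Haar measure under inversion. -/

section Unimodular

variable {G : Type*} [Group G]

theorem mk_mul_center (g : G) (z : Subgroup.center G) :
    (QuotientGroup.mk (g * (z : G)) : X G) = QuotientGroup.mk g :=
  QuotientGroup.mk_mul_of_mem g z.2

variable [MeasurableSpace G]

/-- The central part `s(p(g))⁻¹ g` of an element `g`. -/
def BorelSection.centralPart (s : BorelSection G) (g : G) : Subgroup.center G :=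
  ⟨(s (QuotientGroup.mk g : X G))⁻¹ * g, QuotientGroup.eq.1 (s.mk_toFun' _)⟩

theorem BorelSection.section_mul_centralPart (s : BorelSection G) (g : G) :
    s (QuotientGroup.mk g : X G) * s.centralPart g = g := by
  simp [BorelSection.centralPart]

theorem BorelSection.centralPart_mul_center (s : BorelSection G) (g : G)
    (z : Subgroup.center G) : s.centralPart (g * z) = s.centralPart g * z := by
  apply Subtype.ext
  simp [BorelSection.centralPart, mul_assoc]

/-- The set of all `s(x) z` with `x ∈ B` and `z ∈ K`. -/
def BorelSection.box (s : BorelSection G) (B : Set (X G)) (K : Set (Subgroup.center G)) : Set G :=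
  {g | (QuotientGroup.mk g : X G) ∈ B ∧ s.centralPart g ∈ K}

variable [TopologicalSpace G] [IsTopologicalGroup G]
  [T2Space G] [LocallyCompactSpace G] [SecondCountableTopology G] [BorelSpace G]

theorem BorelSection.measurable_centralPart (s : BorelSection G) :
    Measurable s.centralPart := by
  have hp : Measurable (QuotientGroup.mk : G → X G) := QuotientGroup.continuous_mk.measurable
  exact (((s.measurable'.comp hp).inv).mul measurable_id).subtype_mk

/-- The Borel isomorphism `(x, z) ↦ s(x) z` of `X × Z` with `G`. -/
def BorelSection.prodEquiv (s : BorelSection G) : X G × Subgroup.center G ≃ᵐ G where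
  toFun q := s q.1 * (q.2 : G)
  invFun g := (QuotientGroup.mk g, s.centralPart g)
  left_inv q := by
    have h : (QuotientGroup.mk (s q.1 * (q.2 : G)) : X G) = q.1 := by
      rw [mk_mul_center, s.mk_toFun']
    refine Prod.ext h (Subtype.ext ?_)
    change (s (QuotientGroup.mk (s q.1 * (q.2 : G)) : X G))⁻¹ * (s q.1 * (q.2 : G)) = q.2
    rw [h, inv_mul_cancel_left]
  right_inv := s.section_mul_centralPart
  measurable_toFun :=
    (s.measurable'.comp measurable_fst).mul (measurable_subtype_coe.comp measurable_snd)
  measurable_invFun :=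
    QuotientGroup.continuous_mk.measurable.prodMk s.measurable_centralPart

/-- The measure on `G` obtained from measures on `X` and on the centre through the Borel
isomorphism `(x, z) ↦ s(x) z`. -/
noncomputable def BorelSection.glue (s : BorelSection G) (α : Measure (X G))
    (ν : Measure (Subgroup.center G)) : Measure G :=
  (α.prod ν).map s.prodEquiv

variable (s : BorelSection G) (α : Measure (X G)) (ν : Measure (Subgroup.center G))

theorem BorelSection.glue_apply [SFinite ν] {A : Set G} (hA : MeasurableSet A) :
    s.glue α ν A = ∫⁻ x, ν {z | s x * (z : G) ∈ A} ∂α := by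
  rw [BorelSection.glue, s.prodEquiv.map_apply, Measure.prod_apply (s.prodEquiv.measurable hA)]
  rfl

instance [SigmaFinite α] [SigmaFinite ν] : SigmaFinite (s.glue α ν) :=
  s.prodEquiv.sigmaFinite_map

/-- Since `g s(x) = s(p(g) x) z` with `z` central, left translation by `g` translates the base by
`p(g)` and each fibre by a central element depending on `x`; invariance of `α` and `ν` absorbs both.
-/
theorem BorelSection.glue_isMulLeftInvariant [SFinite ν] [α.IsMulLeftInvariant]
    [ν.IsMulLeftInvariant] : (s.glue α ν).IsMulLeftInvariant := by
  refine ⟨fun g => ?_⟩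
  ext A hA
  rw [Measure.map_apply (measurable_const_mul g) hA,
    s.glue_apply α ν (measurable_const_mul g hA), s.glue_apply α ν hA,
    ← lintegral_mul_left_eq_self (fun x => ν {z | s x * (z : G) ∈ A})
      (QuotientGroup.mk g : X G)]
  refine lintegral_congr fun x => ?_
  have hx : (QuotientGroup.mk (g * s x) : X G) = QuotientGroup.mk g * x := by
    rw [QuotientGroup.mk_mul, s.mk_toFun']
  have h := s.section_mul_centralPart (g * s x)
  rw [hx] at h
  rw [← measure_preimage_mul ν (s.centralPart (g * s x))
    {z | s ((QuotientGroup.mk g : X G) * x) * (z : G) ∈ A}]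
  congr 1
  ext z
  simp only [Set.mem_preimage, Set.mem_ofPred_eq, Subgroup.coe_mul]
  rw [← mul_assoc (s _), h, mul_assoc]

theorem BorelSection.measurableSet_box {B : Set (X G)} {K : Set (Subgroup.center G)}
    (hB : MeasurableSet B) (hK : MeasurableSet K) : MeasurableSet (s.box B K) :=
  (QuotientGroup.continuous_mk.measurable hB).inter (s.measurable_centralPart hK)

/-- The central coordinate commutes with `g`, so right translation also shifts the fibres only by
central elements. The fibre contributes the constant `ν K`, which isolates the effect of the right
translation on `α`. -/
theorem BorelSection.glue_preimage_mul_right_box [SFinite ν] [ν.IsMulLeftInvariant]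
    {B : Set (X G)} {K : Set (Subgroup.center G)} (hB : MeasurableSet B)
    (hK : MeasurableSet K) (g : G) :
    s.glue α ν ((· * g) ⁻¹' s.box B K) = ν K * α ((· * (QuotientGroup.mk g : X G)) ⁻¹' B) := by
  rw [s.glue_apply α ν (measurable_mul_const g (s.measurableSet_box hB hK))]
  have hBg : MeasurableSet ((· * (QuotientGroup.mk g : X G)) ⁻¹' B) :=
    measurable_mul_const _ hB
  rw [← lintegral_indicator_const hBg]
  refine lintegral_congr fun x => ?_
  have h1 : ∀ z : Subgroup.center G, s x * (z : G) * g = s x * g * z := fun z => by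
    rw [mul_assoc, mul_assoc, (Subgroup.mem_center_iff.1 z.2 g)]
  have h2 : (QuotientGroup.mk (s x * g) : X G) = x * QuotientGroup.mk g := by
    rw [QuotientGroup.mk_mul, s.mk_toFun']
  by_cases hx : x * (QuotientGroup.mk g : X G) ∈ B
  · rw [Set.indicator_of_mem (show x ∈ _ from hx),
      ← measure_preimage_mul ν (s.centralPart (s x * g)) K]
    congr 1
    ext z
    change (QuotientGroup.mk (s x * (z : G) * g) : X G) ∈ B ∧
      s.centralPart (s x * (z : G) * g) ∈ K ↔ _
    rw [h1, mk_mul_center, h2, s.centralPart_mul_center, Set.mem_preimage, and_iff_right hx]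
  · rw [Set.indicator_of_notMem (show x ∉ _ from hx)]
    convert measure_empty (μ := ν)
    ext z
    change (QuotientGroup.mk (s x * (z : G) * g) : X G) ∈ B ∧
      s.centralPart (s x * (z : G) * g) ∈ K ↔ _
    rw [h1, mk_mul_center, h2]
    simp [hx]

include s in
/-- The quotient of a unimodular group by its centre is unimodular. -/
theorem isMulRightInvariant_of_unimodular (μ : Measure G) [μ.IsHaarMeasure]
    [μ.IsMulRightInvariant] [α.IsHaarMeasure] : α.IsMulRightInvariant := by
  have : LocallyCompactSpace (Subgroup.center G) :=
    (instIsClosedCenter G).isClosedEmbedding_subtypeVal.locallyCompactSpace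
  let K₀ : TopologicalSpace.PositiveCompacts (Subgroup.center G) := Classical.arbitrary _
  let ν : Measure (Subgroup.center G) := Measure.haarMeasure K₀
  have : SigmaFinite ν := by
    have : SecondCountableTopology (Subgroup.center G) :=
      TopologicalSpace.Subtype.secondCountableTopology _
    infer_instance
  have hK0 : ν K₀ ≠ 0 := (Measure.measure_pos_of_nonempty_interior _ K₀.interior_nonempty).ne'
  have hK1 : ν K₀ ≠ ∞ := K₀.isCompact.measure_lt_top.ne
  have hK : MeasurableSet (K₀ : Set (Subgroup.center G)) := K₀.isCompact.measurableSet
  have := s.glue_isMulLeftInvariant α ν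
  let L : TopologicalSpace.PositiveCompacts G := Classical.arbitrary _
  -- Uniqueness of left-invariant measures needs only σ-finiteness of the glued measure, not
  -- finiteness on compact sets. Right invariance is thus inherited from `μ`.
  have hm : s.glue α ν = (s.glue α ν L / μ L) • μ :=
    measure_eq_div_smul _ _
      (Measure.measure_pos_of_nonempty_interior _ L.interior_nonempty).ne'
      L.isCompact.measure_lt_top.ne
  refine ⟨fun x => ?_⟩
  obtain ⟨g, rfl⟩ := QuotientGroup.mk_surjective x
  ext B hB
  rw [Measure.map_apply (measurable_mul_const _) hB]
  have h1 := s.glue_preimage_mul_right_box α ν hB hK g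
  have h2 := s.glue_preimage_mul_right_box α ν hB hK 1
  have h3 : s.glue α ν ((· * g) ⁻¹' s.box B K₀) = s.glue α ν ((· * 1) ⁻¹' s.box B K₀) := by
    rw [hm]
    simp only [Measure.smul_apply, measure_preimage_mul_right]
  rw [h1, h2] at h3
  simpa using (ENNReal.mul_right_inj hK0 hK1).1 h3

end Unimodular

/-- A Haar measure on a second countable unimodular group is invariant under inversion. -/
theorem isInvInvariant_of_isMulRightInvariant {Y : Type*} [Group Y] [TopologicalSpace Y]
    [IsTopologicalGroup Y] [LocallyCompactSpace Y] [SecondCountableTopology Y]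
    [MeasurableSpace Y] [BorelSpace Y] (α : Measure Y) [α.IsHaarMeasure]
    [α.IsMulRightInvariant] : α.IsInvInvariant := by
  let K : TopologicalSpace.PositiveCompacts Y := Classical.arbitrary _
  -- On a symmetric set `α` and `α.inv` agree, so their proportionality constant is 1.
  let S : Set Y := (K : Set Y) ∪ (K : Set Y)⁻¹
  have hS0 : α S ≠ 0 := ((Measure.measure_pos_of_nonempty_interior α K.interior_nonempty).trans_le
    (measure_mono Set.subset_union_left)).ne'
  have hS1 : α S ≠ ∞ := (K.isCompact.union K.isCompact.inv).measure_lt_top.ne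
  have hS : S⁻¹ = S := by simp [S, Set.union_comm]
  refine ⟨?_⟩
  have h := measure_eq_div_smul α.inv α hS0 hS1
  rwa [Measure.inv_apply, hS, ENNReal.div_self hS0 hS1, one_smul] at h

/-! ### Schur's lemma and the central character. -/

section Schur

variable {G : Type*} [Group G] [TopologicalSpace G]
  {H : Type*} [NormedAddCommGroup H] [InnerProductSpace ℂ H] [CompleteSpace H]

namespace UnitaryRep

variable (π : UnitaryRep G H)

theorem op_mul (g h : G) : π.op (g * h) = π.op g * π.op h := by simp [UnitaryRep.op]

theorem op_one : π.op 1 = 1 := by simp [UnitaryRep.op]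

theorem star_op (g : G) : star (π.op g) = π.op g⁻¹ := by
  rw [UnitaryRep.op, UnitaryRep.op, map_inv, ← Unitary.star_eq_inv]
  rfl

theorem inner_op_left (g : G) (v w : H) : ⟪π.op g v, w⟫_ℂ = ⟪v, π.op g⁻¹ w⟫_ℂ := by
  rw [← star_op, ContinuousLinearMap.star_eq_adjoint, ContinuousLinearMap.adjoint_inner_right]

theorem op_inv_op (g : G) (v : H) : π.op g⁻¹ (π.op g v) = v := by
  rw [← mul_apply_eq_comp, ← op_mul, inv_mul_cancel, op_one]
  rfl

theorem norm_op (g : G) (v : H) : ‖π.op g v‖ = ‖v‖ := by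
  rw [@norm_eq_sqrt_re_inner ℂ, inner_op_left, op_inv_op, ← @norm_eq_sqrt_re_inner ℂ]

variable {π}

/-- Schur's lemma: a normal operator that commutes with an irreducible unitary representation is
a scalar. -/
theorem IsIrreducible.exists_eq_smul_one (hirr : π.IsIrreducible) {T : H →L[ℂ] H}
    (hT : IsStarNormal T) (hcomm : ∀ g, Commute T (π.op g)) :
    ∃ c : ℂ, T = c • (1 : H →L[ℂ] H) := by
  have : Nontrivial H := hirr.1
  -- The continuous functional calculus of `T` commutes with `π(g)` only if `star T` does too; this
  -- follows by taking adjoints at `g⁻¹`.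
  have hcomm' : ∀ g, Commute (star T) (π.op g) := fun g => by
    have h := (hcomm g⁻¹).star_star
    rwa [star_op, inv_inv] at h
  obtain ⟨a, ha⟩ := spectrum.nonempty T
  refine ⟨a, ?_⟩
  by_cases hb : ∃ b ∈ spectrum ℂ T, b ≠ a
  · exfalso
    obtain ⟨b, hb, hba⟩ := hb
    -- Bumps of radius `r` around two distinct spectral points have product zero, while neither
    -- `f_a(T)` nor `f_b(T)` vanishes. The kernel of `f_a(T)` is then a closed invariant subspace
    -- that contains the range of `f_b(T)` and is not all of `H`.
    let r : ℝ := dist b a / 2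
    have hr : 0 < r := half_pos (dist_pos.2 hba)
    let f : ℂ → ℂ → ℂ := fun c z => ((max 0 (r - dist z c) : ℝ) : ℂ)
    have hfc : ∀ c, Continuous (f c) := fun c => by fun_prop
    have hf0 : ∀ c ∈ spectrum ℂ T, cfc (f c) T ≠ 0 := by
      intro c hc h0
      have h1 : f c c ∈ spectrum ℂ (cfc (f c) T) := by
        rw [cfc_map_spectrum (f c) T hT (hfc c).continuousOn]
        exact ⟨c, hc, rfl⟩
      rw [h0, spectrum.zero_eq, Set.mem_singleton_iff] at h1
      simp only [f, dist_self, sub_zero, Complex.ofReal_eq_zero] at h1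
      rw [max_eq_right hr.le] at h1
      exact hr.ne' h1
    have hmul : cfc (f a) T * cfc (f b) T = 0 := by
      rw [← cfc_mul (f a) (f b) T (hfc a).continuousOn (hfc b).continuousOn]
      have : (fun z => f a z * f b z) = fun _ => 0 := by
        funext z
        have htri : dist b a ≤ dist z b + dist z a := dist_triangle_left b a z
        by_cases h : r ≤ dist z a
        · simp [f, max_eq_left (sub_nonpos.2 h)]
        · have : r ≤ dist z b := by
            have : dist b a = r + r := by simp [r]
            linarith
          simp [f, max_eq_left (sub_nonpos.2 this)]
      rw [this]
      exact cfc_zero ℂ T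
    rcases hirr.2 (LinearMap.ker (cfc (f a) T : H →L[ℂ] H).toLinearMap)
      (cfc (f a) T : H →L[ℂ] H).isClosed_ker (fun g v hv => by
        have h := congrArg (fun S : H →L[ℂ] H => S v) ((hcomm g).cfc (hcomm' g) (f a)).eq
        simp only [mul_apply_eq_comp] at h
        change (cfc (f a) T : H →L[ℂ] H) v = 0 at hv
        change (cfc (f a) T : H →L[ℂ] H) (π.op g v) = 0
        rw [h, hv, map_zero]) with h | h
    · refine hf0 b hb (ContinuousLinearMap.ext fun v => ?_)
      have : cfc (f b) T v ∈ LinearMap.ker (cfc (f a) T : H →L[ℂ] H).toLinearMap :=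
        congrArg (fun S : H →L[ℂ] H => S v) hmul
      rw [h] at this
      exact this
    · refine hf0 a ha (ContinuousLinearMap.ext fun v => ?_)
      have : v ∈ LinearMap.ker (cfc (f a) T : H →L[ℂ] H).toLinearMap := by
        rw [h]; trivial
      exact this
  · push Not at hb
    have h1 : cfc (fun z : ℂ => z) T = cfc (fun _ : ℂ => a) T :=
      cfc_congr fun z hz => hb z hz
    rw [cfc_id' ℂ T, cfc_const a T, Algebra.algebraMap_eq_smul_one] at h1
    exact h1

/-- An irreducible unitary representation has a central character. -/
theorem IsIrreducible.exists_isCentralCharacter (hirr : π.IsIrreducible) :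
    ∃ χ : Subgroup.center G →ₜ* Circle, π.IsCentralCharacter χ := by
  have : Nontrivial H := hirr.1
  have hc : ∀ h : Subgroup.center G, ∃ c : ℂ, π.op h = c • (1 : H →L[ℂ] H) := fun h => by
    refine hirr.exists_eq_smul_one ⟨?_⟩ fun g => ?_
    · rw [star_op, Commute, SemiconjBy, ← op_mul, ← op_mul, inv_mul_cancel, mul_inv_cancel]
    · rw [Commute, SemiconjBy, ← op_mul, ← op_mul, Subgroup.mem_center_iff.1 h.2 g]
  choose c hc using hc
  obtain ⟨v, hv⟩ := exists_norm_eq H zero_le_one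
  -- As a matrix coefficient at a unit vector, `c` inherits continuity from the strong continuity of
  -- `π`.
  have hinner : ∀ h, c h = ⟪v, π.op h v⟫_ℂ := fun h => by
    rw [hc h]
    simp [inner_self_eq_norm_sq_to_K, hv]
  have hnorm : ∀ h, ‖c h‖ = 1 := fun h => by
    have := π.norm_op h v
    rw [hc h] at this
    simpa [norm_smul, hv] using this
  have hcont : Continuous c := by
    rw [show c = _ from funext hinner]
    exact continuous_const.inner ((π.continuous' v).comp continuous_subtype_val)
  have hmul : ∀ h k, c (h * k) = c h * c k := fun h k => by
    rw [hinner, Subgroup.coe_mul, op_mul, hc h, hc k]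
    simp [inner_self_eq_norm_sq_to_K, hv, mul_comm]
  have hone : c 1 = 1 := by
    rw [hinner, Subgroup.coe_one, op_one]
    simp [inner_self_eq_norm_sq_to_K, hv]
  refine ⟨⟨⟨⟨fun h => ⟨c h, mem_sphere_zero_iff_norm.2 (hnorm h)⟩, ?_⟩, ?_⟩, ?_⟩, hc⟩
  · exact Subtype.ext hone
  · exact fun h k => Subtype.ext (hmul h k)
  · exact hcont.subtype_mk _

end UnitaryRep

end Schur

/-! ### The canonical projection measure. -/

section CanonicalMeasure

variable {G : Type*} [Group G] [TopologicalSpace G] [IsTopologicalGroup G]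
  [T2Space G] [LocallyCompactSpace G] [SecondCountableTopology G]
  [MeasurableSpace G] [BorelSpace G]
  (χ : Subgroup.center G →ₜ* Circle) (s : BorelSection G)
  (μ : Measure G) (α : Measure (X G))

theorem covFunIndicator_section (E : Set (X G)) (hE : MeasurableSet E) (f : covFun χ s α)
    (x : X G) : (covFunIndicator χ s α E hE f).1 (s x) = E.indicator (fun y => f.1 (s y)) x := by
  change ((QuotientGroup.mk : G → X G) ⁻¹' E).indicator f.1 (s x) = _
  by_cases hx : x ∈ E
  · rw [Set.indicator_of_mem hx, Set.indicator_of_mem]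
    rwa [Set.mem_preimage, s.mk_toFun']
  · rw [Set.indicator_of_notMem hx, Set.indicator_of_notMem]
    rwa [Set.mem_preimage, s.mk_toFun']

variable [μ.IsHaarMeasure] [μ.IsMulRightInvariant] [α.IsHaarMeasure]

/-- This reduces self-adjointness and additivity of `P`, the formula for `Q_u` and minimality to set
integrals on `X`. -/
theorem inner_canonicalPM {E : Set (X G)} (hE : MeasurableSet E) (f₁ f₂ : covFun χ s α) :
    ⟪HChi.mk χ s μ α f₁, canonicalPM χ s μ α E (HChi.mk χ s μ α f₂)⟫_ℂ =
      ∫ x in E, (starRingEnd ℂ) (f₁.1 (s x)) * f₂.1 (s x) ∂α := by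
  rw [canonicalPM_mk χ s μ α E hE, HChi.inner_mk_mk, ← integral_indicator hE]
  congr 1
  funext x
  rw [covFunIndicator_section]
  by_cases hx : x ∈ E <;> simp [hx]

theorem canonicalPM_isStarProjection {E : Set (X G)} (hE : MeasurableSet E) :
    IsStarProjection (canonicalPM χ s μ α E) := by
  refine ⟨?_, ?_⟩
  · refine ContinuousLinearMap.ext fun a => ?_
    obtain ⟨f, rfl⟩ := HChi.mk_surjective a
    rw [mul_apply_eq_comp, canonicalPM_mk χ s μ α E hE, canonicalPM_mk χ s μ α E hE]
    refine congrArg _ (Subtype.ext ?_)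
    change (_ : Set G).indicator ((_ : Set G).indicator f.1) = (_ : Set G).indicator f.1
    rw [Set.indicator_indicator, Set.inter_self]
  · rw [ContinuousLinearMap.isSelfAdjoint_iff_isSymmetric]
    intro a b
    obtain ⟨f, rfl⟩ := HChi.mk_surjective a
    obtain ⟨f', rfl⟩ := HChi.mk_surjective b
    change ⟪canonicalPM χ s μ α E (HChi.mk χ s μ α f), HChi.mk χ s μ α f'⟫_ℂ =
      ⟪HChi.mk χ s μ α f, canonicalPM χ s μ α E (HChi.mk χ s μ α f')⟫_ℂ
    rw [← inner_conj_symm, inner_canonicalPM χ s μ α hE, inner_canonicalPM χ s μ α hE,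
      ← integral_conj]
    refine integral_congr_ae (Eventually.of_forall fun x => ?_)
    simp [mul_comm]

theorem canonicalPM_univ : canonicalPM χ s μ α Set.univ = 1 := by
  refine ContinuousLinearMap.ext fun a => ?_
  obtain ⟨f, rfl⟩ := HChi.mk_surjective a
  rw [canonicalPM_mk χ s μ α _ MeasurableSet.univ]
  refine congrArg _ (Subtype.ext ?_)
  exact Set.indicator_univ f.1

theorem canonicalPM_isProjectionMeasure : IsProjectionMeasure (canonicalPM χ s μ α) where
  isPositive E hE :=
    ContinuousLinearMap.IsPositive.of_isStarProjection (canonicalPM_isStarProjection χ s μ α hE)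
  univ := canonicalPM_univ χ s μ α
  hasSum E hE hd a b := by
    obtain ⟨f, rfl⟩ := HChi.mk_surjective a
    obtain ⟨f', rfl⟩ := HChi.mk_surjective b
    rw [inner_canonicalPM χ s μ α (MeasurableSet.iUnion hE)]
    simp only [inner_canonicalPM χ s μ α (hE _)]
    exact hasSum_integral_iUnion hE hd (f.2.2.2.star.integrable_mul f'.2.2.2).integrableOn
  isStarProjection E hE := canonicalPM_isStarProjection χ s μ α hE

end CanonicalMeasure

/-! ### Weak integrals and compressions of projection measures. -/

section Compression

variable {Y : Type*} [MeasurableSpace Y]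
  {H : Type*} [NormedAddCommGroup H] [InnerProductSpace ℂ H]
  {K : Type*} [NormedAddCommGroup K] [InnerProductSpace ℂ K] [CompleteSpace K]

theorem IsWeakIntegral.unique {F : Y → H →L[ℂ] H} {ν : Measure Y} {A B : H →L[ℂ] H}
    (hA : IsWeakIntegral F ν A) (hB : IsWeakIntegral F ν B) : A = B := by
  refine ContinuousLinearMap.ext fun w => ext_inner_left ℂ fun v => ?_
  rw [(hA v w).2, (hB v w).2]

theorem IsWeakIntegral.weakIntegral_eq [CompleteSpace H] {F : Y → H →L[ℂ] H} {ν : Measure Y}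
    {A : H →L[ℂ] H} (hA : IsWeakIntegral F ν A) : weakIntegral F ν = A := by
  have h : ∃ A, IsWeakIntegral F ν A := ⟨A, hA⟩
  rw [weakIntegral, dif_pos h]
  exact h.choose_spec.unique hA

/-- The compression of a projection measure along an isometry is a positive operator measure,
with the projection measure as a dilation. -/
theorem IsProjectionMeasure.isNeumarkDilation {P : Set Y → K →L[ℂ] K}
    (hP : IsProjectionMeasure P) {Q : Set Y → H →L[ℂ] H} {W : H →ₗ[ℂ] K}
    (hW : ∀ v, ‖W v‖ = ‖v‖)
    (hQ : ∀ E, MeasurableSet E → ∀ v w, ⟪v, Q E w⟫_ℂ = ⟪W v, P E (W w)⟫_ℂ) :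
    IsNeumarkDilation Q P W where
  isPOM :=
    { isPositive := fun E hE => by
        have hpos := hP.isPositive E hE
        refine (ContinuousLinearMap.isPositive_iff (Q E)).2 ⟨fun v w => ?_, fun v => ?_⟩
        · change ⟪Q E v, w⟫_ℂ = ⟪v, Q E w⟫_ℂ
          rw [← inner_conj_symm, hQ E hE, hQ E hE, inner_conj_symm]
          exact hpos.isSymmetric _ _
        · rw [← inner_conj_symm, hQ E hE, inner_conj_symm]
          exact hpos.inner_nonneg_left _
      univ := by
        refine ContinuousLinearMap.ext fun w => ext_inner_left ℂ fun v => ?_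
        rw [hQ _ MeasurableSet.univ, hP.univ]
        -- By polarisation, preservation of norms gives preservation of scalar products.
        exact (⟨W, hW⟩ : H →ₗᵢ[ℂ] K).inner_map_map v w
      hasSum := fun E hE hd v w => by
        rw [hQ _ (MeasurableSet.iUnion hE)]
        simp only [hQ _ (hE _)]
        exact hP.hasSum E hE hd _ _ }
  isProjectionMeasure := hP
  isometry := hW
  inner_eq E hE v w := (hQ E hE v w).symm

end Compression

/-! ### Orthogonality relations, the observable `Q_u` and minimality. -/

section Orthogonality

variable {G : Type*} [Group G] [TopologicalSpace G]
  {H : Type*} [NormedAddCommGroup H] [InnerProductSpace ℂ H] [CompleteSpace H]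
  {π : UnitaryRep G H} {χ : Subgroup.center G →ₜ* Circle}

namespace UnitaryRep

theorem coeff_op_right (g g' : G) (u v : H) :
    π.coeff u (π.op g v) g' = π.coeff u v (g⁻¹ * g') := by
  rw [UnitaryRep.coeff, UnitaryRep.coeff, op_mul, mul_apply_eq_comp, inner_op_left π g⁻¹, inv_inv]

theorem coeff_inv (u v : H) (g : G) :
    π.coeff u v g⁻¹ = (starRingEnd ℂ) (π.coeff v u g) := by
  rw [UnitaryRep.coeff, UnitaryRep.coeff, inner_op_left, inv_inv, inner_conj_symm]

variable [MeasurableSpace G] (s : BorelSection G)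

/-- A central factor multiplies both coefficients by the same phase, which cancels in the product.
Such products therefore descend to `X`, and any representative may replace `s(x)`. -/
theorem conj_coeff_mul_coeff_section (hχ : π.IsCentralCharacter χ) (u v u' w : H) (g : G) :
    (starRingEnd ℂ) (π.coeff u v (s (QuotientGroup.mk g : X G))) *
        π.coeff u' w (s (QuotientGroup.mk g : X G)) =
      (starRingEnd ℂ) (π.coeff u v g) * π.coeff u' w g := by
  have hg := s.section_mul_centralPart g
  set z := s.centralPart g
  have hop : ∀ a : H, π.op g a = (χ z : ℂ) • π.op (s (QuotientGroup.mk g : X G)) a := fun a => by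
    conv_lhs => rw [← hg, op_mul, hχ z]
    simp
  have hz : (χ z : ℂ) * (starRingEnd ℂ) (χ z : ℂ) = 1 := by
    rw [Complex.mul_conj, Circle.normSq_coe, Complex.ofReal_one]
  simp only [UnitaryRep.coeff, hop, inner_smul_left, map_mul, Complex.conj_conj]
  linear_combination (-((starRingEnd ℂ) ⟪π.op (s (QuotientGroup.mk g : X G)) u, v⟫_ℂ *
    ⟪π.op (s (QuotientGroup.mk g : X G)) u', w⟫_ℂ)) * hz

theorem inner_orbit_rankOne (u v w : H) (x : X G) :
    ⟪v, π.orbit s (InnerProductSpace.rankOne ℂ u u) x w⟫_ℂ =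
      (starRingEnd ℂ) (π.coeff u v (s x)) * π.coeff u w (s x) := by
  simp [UnitaryRep.orbit, UnitaryRep.coeff, inner_op_left, mul_comm]

variable [IsTopologicalGroup G] [T2Space G] [LocallyCompactSpace G]
  [SecondCountableTopology G] [BorelSpace G]
  (μ : Measure G) [μ.IsHaarMeasure] [μ.IsMulRightInvariant] (α : Measure (X G))

/-- Inversion exchanges the two vectors of a coefficient up to conjugation, and `s(x)⁻¹` may stand
in for `s(x⁻¹)`. -/
theorem integral_norm_coeff_sq_comm [α.IsInvInvariant] (hχ : π.IsCentralCharacter χ) (u v : H) :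
    ∫ x, ‖π.coeff u v (s x)‖ ^ 2 ∂α = ∫ x, ‖π.coeff v u (s x)‖ ^ 2 ∂α := by
  rw [← integral_inv_eq_self (fun x => ‖π.coeff v u (s x)‖ ^ 2) α]
  refine integral_congr_ae (Eventually.of_forall fun x => ?_)
  have h := conj_coeff_mul_coeff_section s hχ v u v u (s x)⁻¹
  rw [QuotientGroup.mk_inv, s.mk_toFun', Complex.conj_mul', Complex.conj_mul', coeff_inv,
    RCLike.norm_conj] at h
  exact_mod_cast h.symm

variable [α.IsHaarMeasure]

variable (hχ : π.IsCentralCharacter χ) (hsq : π.IsSquareIntegrableModCenter s α)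

theorem inner_W_W (u v u' w : H) :
    ⟪π.W χ s μ α hχ hsq u v, π.W χ s μ α hχ hsq u' w⟫_ℂ =
      ∫ x, (starRingEnd ℂ) (π.coeff u v (s x)) * π.coeff u' w (s x) ∂α :=
  HChi.inner_mk_mk χ s μ α _ _

/-- Applying `π(g)` to the second vector left-translates the coefficient, and `α` is left invariant.
-/
theorem inner_W_op_W_op (g : G) (u v w : H) :
    ⟪π.W χ s μ α hχ hsq u (π.op g v), π.W χ s μ α hχ hsq u (π.op g w)⟫_ℂ =
      ⟪π.W χ s μ α hχ hsq u v, π.W χ s μ α hχ hsq u w⟫_ℂ := by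
  rw [inner_W_W, inner_W_W, ← integral_mul_left_eq_self
    (fun x => (starRingEnd ℂ) (π.coeff u v (s x)) * π.coeff u w (s x))
    (QuotientGroup.mk g⁻¹ : X G)]
  refine integral_congr_ae (Eventually.of_forall fun x => ?_)
  have h := conj_coeff_mul_coeff_section s hχ u v u w (g⁻¹ * s x)
  rw [QuotientGroup.mk_mul, s.mk_toFun'] at h
  simp only [coeff_op_right, h]

/-- Closed graph theorem: an `L²` limit of `c_{u,v_n}` is an almost everywhere limit along a
subsequence, while `c_{u,v_n}` converges pointwise to the coefficient of the limit vector. -/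
theorem continuous_W (u : H) : Continuous (π.W χ s μ α hχ hsq u) := by
  refine LinearMap.continuous_of_seq_closed_graph _ fun v x y hv hy => ?_
  have hiso : Isometry (HChi.toLp χ s μ α) :=
    AddMonoidHomClass.isometry_of_norm _ (HChi.norm_toLp χ s μ α)
  have hy' := (hiso.continuous.tendsto y).comp hy
  obtain ⟨ns, hns, hae⟩ := (tendstoInMeasure_of_tendsto_Lp hy').exists_seq_tendsto_ae
  have hcoe : ∀ w : H, HChi.toLp χ s μ α (π.W χ s μ α hχ hsq u w) =ᵐ[α]
      fun x => π.coeff u w (s x) := fun w => (hsq u w).coeFn_toLp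
  apply HChi.toLp_injective χ s μ α
  refine Lp.ext ?_
  filter_upwards [hae, hcoe x, ae_all_iff.2 fun n => hcoe (v n)] with t h1 h2 h3
  rw [h2]
  refine tendsto_nhds_unique h1 ?_
  simp only [Function.comp_apply, h3]
  exact tendsto_const_nhds.inner (hv.comp hns.tendsto_atTop)

theorem IsIrreducible.exists_inner_W_W (hirr : π.IsIrreducible) (u : H) :
    ∃ c : ℂ, ∀ v w : H, ⟪π.W χ s μ α hχ hsq u v, π.W χ s μ α hχ hsq u w⟫_ℂ = c * ⟪v, w⟫_ℂ := by
  let W' : H →L[ℂ] HChi χ s μ α :=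
    ⟨π.W χ s μ α hχ hsq u, continuous_W s μ α hχ hsq u⟩
  let T : H →L[ℂ] H := (ContinuousLinearMap.adjoint W') ∘L W'
  have hT : ∀ v w : H, ⟪v, T w⟫_ℂ =
      ⟪π.W χ s μ α hχ hsq u v, π.W χ s μ α hχ hsq u w⟫_ℂ := fun v w =>
    ContinuousLinearMap.adjoint_inner_right W' v (W' w)
  have hTsa : IsSelfAdjoint T := by
    rw [ContinuousLinearMap.isSelfAdjoint_iff_isSymmetric]
    intro v w
    change ⟪T v, w⟫_ℂ = ⟪v, T w⟫_ℂ
    rw [← inner_conj_symm, hT, hT, inner_conj_symm]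
  obtain ⟨c, hc⟩ := hirr.exists_eq_smul_one hTsa.isStarNormal fun g => by
    refine ContinuousLinearMap.ext fun w => ext_inner_left ℂ fun v => ?_
    have h := inner_W_op_W_op s μ α hχ hsq g u (π.op g⁻¹ v) w
    have hv : π.op g (π.op g⁻¹ v) = v := by
      simpa using π.op_inv_op g⁻¹ v
    rw [hv, ← hT, ← hT] at h
    rw [mul_apply_eq_comp, mul_apply_eq_comp, h, inner_op_left, inv_inv]
  refine ⟨c, fun v w => ?_⟩
  rw [← hT, hc]
  simp

theorem integral_norm_coeff_sq (u v : H) :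
    ((∫ x, ‖π.coeff u v (s x)‖ ^ 2 ∂α : ℝ) : ℂ) =
      ⟪π.W χ s μ α hχ hsq u v, π.W χ s μ α hχ hsq u v⟫_ℂ := by
  rw [inner_W_W, ← integral_complex_ofReal]
  refine integral_congr_ae (Eventually.of_forall fun x => ?_)
  simp [Complex.conj_mul']

/-- The orthogonality relation for matrix coefficients with formal degree one: `W_u` is an
isometry when `u` is a unit vector. -/
theorem IsIrreducible.norm_W (hirr : π.IsIrreducible) (hdeg : π.HasUnitFormalDegree s α)
    {u : H} (hu : ‖u‖ = 1) (v : H) : ‖π.W χ s μ α hχ hsq u v‖ = ‖v‖ := by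
  have := isMulRightInvariant_of_unimodular s α μ
  have := isInvInvariant_of_isMulRightInvariant α
  obtain ⟨u₀, v₀, hu₀, hv₀, hone⟩ := hdeg
  obtain ⟨c, hc⟩ := hirr.exists_inner_W_W s μ α hχ hsq u
  obtain ⟨c₀, hc₀⟩ := hirr.exists_inner_W_W s μ α hχ hsq u₀
  have h₀ : c₀ = 1 := by
    have h := integral_norm_coeff_sq s μ α hχ hsq u₀ v₀
    rw [hone, hc₀, inner_self_eq_norm_sq_to_K, hv₀] at h
    simpa using h.symm
  -- Evaluated at `u₀`: `c = ‖W_u u₀‖² = ‖W_{u₀} u‖² = c₀`.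
  have h1 : c = 1 := by
    have h := integral_norm_coeff_sq s μ α hχ hsq u u₀
    rw [integral_norm_coeff_sq_comm s α hχ, integral_norm_coeff_sq s μ α hχ hsq, hc, hc₀, h₀,
      inner_self_eq_norm_sq_to_K, inner_self_eq_norm_sq_to_K, hu, hu₀] at h
    simpa using h.symm
  rw [@norm_eq_sqrt_re_inner ℂ, hc, h1, one_mul, ← @norm_eq_sqrt_re_inner ℂ]

include μ hχ hsq in
-- The bounded operator `W_u* P(E) W_u` has the required matrix elements, so the default value in
-- `weakIntegral` is never taken here.
theorem isWeakIntegral_orbit (u : H) {E : Set (X G)} (hE : MeasurableSet E) :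
    IsWeakIntegral (π.orbit s (InnerProductSpace.rankOne ℂ u u)) (α.restrict E)
      (π.pureObs s α u E) := by
  let W' : H →L[ℂ] HChi χ s μ α :=
    ⟨π.W χ s μ α hχ hsq u, continuous_W s μ α hχ hsq u⟩
  have h : IsWeakIntegral (π.orbit s (InnerProductSpace.rankOne ℂ u u)) (α.restrict E)
      (ContinuousLinearMap.adjoint W' ∘L canonicalPM χ s μ α E ∘L W') := by
    intro v w
    simp only [inner_orbit_rankOne]
    refine ⟨((hsq u v).star.integrable_mul (hsq u w)).integrableOn, ?_⟩
    rw [ContinuousLinearMap.comp_apply, ContinuousLinearMap.adjoint_inner_right]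
    exact inner_canonicalPM χ s μ α hE _ _
  rw [UnitaryRep.pureObs, UnitaryRep.phaseSpaceObs, h.weakIntegral_eq]
  exact h

theorem isMinimalDilation_W [TopologicalSpace.SeparableSpace H] {u : H} (hu : u ≠ 0) :
    IsMinimalDilation (canonicalPM χ s μ α) (π.W χ s μ α hχ hsq u) := by
  rw [IsMinimalDilation, Submodule.topologicalClosure_eq_top_iff, Submodule.eq_bot_iff]
  intro a ha
  obtain ⟨f, rfl⟩ := HChi.mk_surjective a
  rw [Submodule.mem_orthogonal'] at ha
  have hzero : ∀ v : H, ∀ᵐ x ∂α, (starRingEnd ℂ) (f.1 (s x)) * π.coeff u v (s x) = 0 := by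
    intro v
    have hint : Integrable (fun x => (starRingEnd ℂ) (f.1 (s x)) * π.coeff u v (s x)) α :=
      f.2.2.2.star.integrable_mul (hsq u v)
    refine hint.ae_eq_zero_of_forall_setIntegral_eq_zero fun E hE _ => ?_
    have h := ha _ (Submodule.subset_span ⟨E, hE, _, ⟨v, rfl⟩, rfl⟩)
    rw [← h]
    symm
    exact inner_canonicalPM χ s μ α hE f _
  have hf : (fun x => f.1 (s x)) =ᵐ[α] 0 := by
    -- The exceptional null set depends on `v`; a countable dense family leaves a single one, and
    -- continuity in `v` recovers all vectors.
    filter_upwards [ae_all_iff.2 fun n => hzero (TopologicalSpace.denseSeq H n)] with x hx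
    by_contra hne
    have hne' : (starRingEnd ℂ) (f.1 (s x)) ≠ 0 := (map_ne_zero _).2 hne
    have h0 : (fun v => π.coeff u v (s x)) = fun _ => 0 :=
      Continuous.ext_on (TopologicalSpace.denseRange_denseSeq H)
        (continuous_const.inner continuous_id) continuous_const (by
          rintro _ ⟨n, rfl⟩
          exact (mul_eq_zero.1 (hx n)).resolve_left hne')
    have h1 : π.op (s x) u = 0 := inner_self_eq_zero.1 (congrFun h0 (π.op (s x) u))
    exact hu (norm_eq_zero.1 (by rw [← π.norm_op (s x) u, h1, norm_zero]))
  exact (Submodule.Quotient.mk_eq_zero _).2 ((covFun_ae_zero_iff (μ := μ) f.2).2 hf)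

end UnitaryRep

end Orthogonality

end PhaseSpace

theorem mainTheorem5
    {G : Type*} [Group G] [TopologicalSpace G] [IsTopologicalGroup G] [T2Space G]
    [LocallyCompactSpace G] [SecondCountableTopology G] [MeasurableSpace G] [BorelSpace G]
    (s : PhaseSpace.BorelSection G)
    (μ : Measure G) [μ.IsHaarMeasure] [μ.IsMulRightInvariant]
    (α : Measure (PhaseSpace.X G)) [α.IsHaarMeasure]
    {H : Type*} [NormedAddCommGroup H] [InnerProductSpace ℂ H] [CompleteSpace H]
    [TopologicalSpace.SeparableSpace H]
    (π : PhaseSpace.UnitaryRep G H) (hirr : π.IsIrreducible)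
    (hsq : π.IsSquareIntegrableModCenter s α) (hdeg : π.HasUnitFormalDegree s α) :
    (∃ χ : Subgroup.center G →ₜ* Circle, π.IsCentralCharacter χ) ∧
    ∀ (χ : Subgroup.center G →ₜ* Circle) (hχ : π.IsCentralCharacter χ) (u : H), ‖u‖ = 1 →
      (∀ E, MeasurableSet E →
        PhaseSpace.IsWeakIntegral (π.orbit s (InnerProductSpace.rankOne ℂ u u)) (α.restrict E)
          (π.pureObs s α u E)) ∧
      PhaseSpace.IsNeumarkDilation (π.pureObs s α u) (PhaseSpace.canonicalPM χ s μ α)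
        (π.W χ s μ α hχ hsq u) ∧
      PhaseSpace.IsMinimalDilation (PhaseSpace.canonicalPM χ s μ α) (π.W χ s μ α hχ hsq u) := by
  refine ⟨hirr.exists_isCentralCharacter, fun χ hχ u hu => ?_⟩
  have hQ := fun E (hE : MeasurableSet E) =>
    PhaseSpace.UnitaryRep.isWeakIntegral_orbit s μ α hχ hsq u hE
  refine ⟨hQ, ?_, PhaseSpace.UnitaryRep.isMinimalDilation_W s μ α hχ hsq ?_⟩
  · refine (PhaseSpace.canonicalPM_isProjectionMeasure χ s μ α).isNeumarkDilation
      (hirr.norm_W s μ α hχ hsq hdeg hu) fun E hE v w => ?_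
    rw [(hQ E hE v w).2]
    simp only [PhaseSpace.UnitaryRep.inner_orbit_rankOne]
    symm
    exact PhaseSpace.inner_canonicalPM χ s μ α hE _ _
  · rintro rfl
    simp at hu
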